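/- Consider unconstrained online linear optimization on $\mathbb{R}^d$, $d\ge 1$, with Euclidean norm $\|\cdot\|$. A deterministic algorithm $\mathcal{A}$ predicts in each round $t=1,2,\dots$ a vector $x_t\in\mathbb{R}^d$ that is a function of the past gradients $g_1,\dots,g_{t-1}$; an adversary $adv$ then chooses $g_t$ with $\|g_t\|\le 1$ as an arbitrary function of $x_1,\dots,x_t$. The regret is $$\mathrm{Regret}_T^{\mathcal{A},adv}(u)=\sum_{t=1}^T\langle g_t,x_t\rangle-\sum_{t=1}^T\langle g_t,u\rangle,\qquad u\in\mathbb{R}^d .$$ For $C>0$ let $$\bar V_{1/2}(t,S)=C\sqrt t\left[2\int_0^{S/\sqrt{2t}}\left(\int_0^v e^{x^2}\,dx\right)dv-1\right],\qquad t>0,\ S\in\mathbb{R},$$ and let $\mathcal{A}_{1/2}$ (with parameter $C$) be the following algorithm. Start with $z_1=0\in\mathbb{R}^d$ and $S_1=0\in\mathbb{R}$. In round $t$, predict $x_t=y_tz_t$ with $y_t=\frac12\left[\bar V_{1/2}(t,S_t+1)-\bar V_{1/2}(t,S_t-1)\right]$; after observing $g_t$, set $S_{t+1}=S_t-\langle g_t,z_t\rangle$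 and $z_{t+1}=\Pi(z_t-g_t/\sqrt t)$, where $\Pi$ is the Euclidean projection onto the closed unit ball. (i) For every $C>0$, $$\limsup_{U\to\infty}\ \limsup_{T\to\infty}\ \sup_{\|u\|=U,\ adv}\frac{\mathrm{Regret}_T^{\mathcal{A}_{1/2},adv}(u)}{\|u\|\sqrt{T\log\|u\|}}\le\sqrt2 .$$ (ii) Conversely, for every $C\in\mathbb{R}$ and every algorithm $\mathcal{A}$ such that $\mathrm{Regret}_T^{\mathcal{A},adv}(0)\le C\sqrt T$ for all adversaries $adv$ and all $T\ge1$, $$\liminf_{U\to\infty}\ \liminf_{T\to\infty}\ \sup_{\|u\|=U,\ adv}\frac{\mathrm{Regret}_T^{\mathcal{A},adv}(u)}{\|u\|\sqrt{T\log\|u\|}}\ge\sqrt2 .$$ (iii) For every $C>0$, the algorithm $\mathcal{A}_{1/2}$ with parameter $C$ satisfies the condition in (ii) with the same $C$; hence its leading constant $\sqrt2$ is optimal. -/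

import Mathlib

/-! Unconstrained online linear optimization (OLO) on `ℝ^d`.
Rounds are indexed from `0`: index `t : ℕ` is the `(t + 1)`-st round. -/

namespace OLO

/-- Euclidean space `ℝ^d`. -/
abbrev E (d : ℕ) : Type := EuclideanSpace ℝ (Fin d)

/-- Admissible loss gradients: vectors of Euclidean norm at most `1`. -/
abbrev Gradient (d : ℕ) : Type := Metric.closedBall (0 : E d) 1

/-- A deterministic OLO algorithm: the prediction of round `t` is a function of the `t` loss
gradients observed before. -/
abbrev Algorithm (d : ℕ) : Type := (t : ℕ) → (Fin t → Gradient d) → E d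

/-- An adversary: the loss gradient of round `t` is an arbitrary function of all predictions
made up to and including round `t`. -/
abbrev Adversary (d : ℕ) : Type := (t : ℕ) → (Fin (t + 1) → E d) → Gradient d

noncomputable section

/-- The first `t` loss gradients in the game between an algorithm and an adversary. -/
def history {d : ℕ} (A : Algorithm d) (adv : Adversary d) : (t : ℕ) → Fin t → Gradient d
  | 0 => Fin.elim0
  | t + 1 =>
    Fin.snoc (α := fun _ => Gradient d) (history A adv t)
      (adv t fun s : Fin (t + 1) =>
        A s fun i : Fin s => history A adv t (Fin.castLE (Nat.lt_succ_iff.mp s.isLt) i))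

/-- The prediction of round `t` in the game. -/
def prediction {d : ℕ} (A : Algorithm d) (adv : Adversary d) (t : ℕ) : E d :=
  A t (history A adv t)

/-- The loss gradient of round `t` in the game. -/
def lossGradient {d : ℕ} (A : Algorithm d) (adv : Adversary d) (t : ℕ) : E d :=
  (history A adv (t + 1) (Fin.last t) : E d)

/-- The regret after `T` rounds with respect to the comparator `u`. -/
def regret {d : ℕ} (A : Algorithm d) (adv : Adversary d) (T : ℕ) (u : E d) : ℝ :=
  ∑ t ∈ Finset.range T, inner ℝ (lossGradient A adv t) (prediction A adv t)
    - ∑ t ∈ Finset.range T, inner ℝ (lossGradient A adv t) u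

/-- The supremum over all adversaries and all comparators of norm `U` of
`regret / (‖u‖ √(T log ‖u‖))`, as an extended real number. -/
def worstRatio {d : ℕ} (A : Algorithm d) (U : ℝ) (T : ℕ) : EReal :=
  ⨆ (u : E d) (_ : ‖u‖ = U) (adv : Adversary d),
    ((regret A adv T u / (‖u‖ * √(T * Real.log ‖u‖)) : ℝ) : EReal)

/-- The Euclidean projection onto the closed unit ball. -/
def projBall {d : ℕ} (v : E d) : E d := (max 1 ‖v‖)⁻¹ • v

/-- Projected online gradient descent on the unit ball, started at the origin, with learning
rate `1 / √t` in the `t`-th round (counted from `1`). -/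
def ogd {d : ℕ} : Algorithm d
  | 0, _ => 0
  | t + 1, g => projBall (ogd t (Fin.init g) - (1 / √((t : ℝ) + 1)) • (g (Fin.last t) : E d))

/-- The statistic `S`, equal to minus the sum of the past inner products `⟪g, z⟫`, where `z` is
the prediction of online gradient descent. -/
def statistic {d : ℕ} : (t : ℕ) → (Fin t → Gradient d) → ℝ
  | 0, _ => 0
  | t + 1, g =>
    statistic t (Fin.init g) - inner ℝ (g (Fin.last t) : E d) (ogd t (Fin.init g))

/-- The OLO algorithm constructed from a one-dimensional potential `V (t, S)`. -/
def potentialAlgorithm (d : ℕ) (V : ℝ → ℝ → ℝ) : Algorithm d := fun t g =>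
  ((V ((t : ℝ) + 1) (statistic t g + 1) - V ((t : ℝ) + 1) (statistic t g - 1)) / 2) • ogd t g

/-- The potential `V_{1/2}` with scaling constant `C`. -/
def potentialHalf (C : ℝ) (t S : ℝ) : ℝ :=
  C * √t * (2 * (∫ v in (0 : ℝ)..(S / √(2 * t)), ∫ x in (0 : ℝ)..v, Real.exp (x ^ 2)) - 1)

/-- The algorithm `A_{1/2}` with scaling constant `C`. -/
def algorithmHalf (d : ℕ) (C : ℝ) : Algorithm d := potentialAlgorithm d (potentialHalf C)

end

end OLO

/-! Upper bound: for `t > 0` the potential V is convex in S, solves the backward heat equation and,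
by the trapezoidal estimate `expSqIntegral_sub_le`, satisfies its discrete version as an inequality
(`potentialHalf_heat_step`). The prediction is a chord slope of V times the gradient-descent point,
so the losses telescope to at most -V(T, S) (`algorithmHalf_loss_le`). Since V ≥ -C√T, this proves
(iii). For general u, gradient descent tracks the direction u/‖u‖ at cost 3‖u‖√T. What remains is
the convex conjugate of V(T, ·) at U = ‖u‖, which is U√(2T log U) to leading order because V grows
like exp(S²/2T).

Lower bound: gradients ±e turn the game into a ±1 walk S. For any walk martingale Φ, some path has
loss plus terminal Φ at least the initial Φ (`exists_gradients_le_loss_add`). Let Φ be positive at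
the end only for S/√T near √(2 log U), scaled to start above the budget C√T. The budget then forces
S to end there, which earns U√(2T log U) against U • e. The Gaussian weight of that region is about
1/U, so the terminal Φ, which bounds the algorithm's gain, is only O(U√T). -/

namespace OLO

noncomputable section

/-! ### Integrals of exp(x²) -/

/-- The integral of `exp (x ^ 2)` from `0` to `z`. -/
def expSqIntegral (z : ℝ) : ℝ := ∫ x in (0 : ℝ)..z, Real.exp (x ^ 2)

/-- The twofold iterated integral of `exp (x ^ 2)`. -/
def expSqDoubleIntegral (z : ℝ) : ℝ := ∫ v in (0 : ℝ)..z, expSqIntegral v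

theorem hasDerivAt_expSqIntegral (z : ℝ) :
    HasDerivAt expSqIntegral (Real.exp (z ^ 2)) z := by
  have hc : Continuous fun x : ℝ => Real.exp (x ^ 2) := by fun_prop
  exact intervalIntegral.integral_hasDerivAt_right (hc.intervalIntegrable _ _)
    (hc.stronglyMeasurableAtFilter _ _) hc.continuousAt

theorem continuous_expSqIntegral : Continuous expSqIntegral :=
  continuous_iff_continuousAt.2 fun z => (hasDerivAt_expSqIntegral z).continuousAt

theorem hasDerivAt_expSqDoubleIntegral (z : ℝ) :
    HasDerivAt expSqDoubleIntegral (expSqIntegral z) z :=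
  intervalIntegral.integral_hasDerivAt_right (continuous_expSqIntegral.intervalIntegrable _ _)
    (continuous_expSqIntegral.stronglyMeasurableAtFilter _ _) continuous_expSqIntegral.continuousAt

theorem expSqIntegral_zero : expSqIntegral 0 = 0 := by simp [expSqIntegral]

theorem expSqDoubleIntegral_zero : expSqDoubleIntegral 0 = 0 := by simp [expSqDoubleIntegral]

theorem monotone_expSqIntegral : Monotone expSqIntegral :=
  monotone_of_deriv_nonneg (fun z => (hasDerivAt_expSqIntegral z).differentiableAt) fun z => by
    rw [(hasDerivAt_expSqIntegral z).deriv]; positivity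

theorem convexOn_expSqDoubleIntegral : ConvexOn ℝ Set.univ expSqDoubleIntegral := by
  have h : deriv expSqDoubleIntegral = expSqIntegral :=
    funext fun z => (hasDerivAt_expSqDoubleIntegral z).deriv
  refine Monotone.convexOn_univ_of_deriv
    (fun z => (hasDerivAt_expSqDoubleIntegral z).differentiableAt) ?_
  rw [h]
  exact monotone_expSqIntegral

/-- The graph of the double integral lies above its tangents. -/
theorem expSqDoubleIntegral_tangent_le (w z : ℝ) :
    expSqDoubleIntegral w + expSqIntegral w * (z - w) ≤ expSqDoubleIntegral z := by
  have hd := hasDerivAt_expSqDoubleIntegral w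
  rcases lt_trichotomy w z with h | h | h
  · have := convexOn_expSqDoubleIntegral.le_slope_of_hasDerivAt (Set.mem_univ _)
      (Set.mem_univ _) h hd
    rw [slope_def_field, le_div_iff₀ (by linarith)] at this
    linarith
  · subst h; simp
  · have := convexOn_expSqDoubleIntegral.slope_le_of_hasDerivAt (Set.mem_univ _)
      (Set.mem_univ _) h hd
    rw [slope_def_field, div_le_iff₀ (by linarith)] at this
    linarith

theorem expSqDoubleIntegral_nonneg (z : ℝ) : 0 ≤ expSqDoubleIntegral z := by
  simpa [expSqIntegral_zero, expSqDoubleIntegral_zero] using expSqDoubleIntegral_tangent_le 0 z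

/-- Integration by parts. It removes the double integral from derivatives of the potential in time.
-/
theorem two_mul_expSqDoubleIntegral (z : ℝ) :
    2 * expSqDoubleIntegral z = 2 * z * expSqIntegral z - Real.exp (z ^ 2) + 1 := by
  have hd (z : ℝ) : HasDerivAt (fun z => 2 * expSqDoubleIntegral z -
      (2 * z * expSqIntegral z - Real.exp (z ^ 2))) 0 z := by
    have h1 := (hasDerivAt_expSqDoubleIntegral z).const_mul 2
    have h2 := ((hasDerivAt_id z).const_mul 2).mul (hasDerivAt_expSqIntegral z)
    have h3 := ((hasDerivAt_id z).pow 2).exp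
    refine (h1.sub (h2.sub h3)).congr_deriv ?_
    simp
    ring
  have := is_const_of_deriv_eq_zero (fun z => (hd z).differentiableAt) (fun z => (hd z).deriv) z 0
  simp only [expSqDoubleIntegral_zero] at this
  norm_num at this
  linarith

theorem convexOn_exp_sq : ConvexOn ℝ Set.univ fun x : ℝ => Real.exp (x ^ 2) := by
  have h : ConvexOn ℝ Set.univ fun x : ℝ => x ^ 2 := Even.convexOn_pow (by decide)
  exact ⟨convex_univ, fun x _ y _ a b ha hb hab =>
    (Real.exp_le_exp.2 (h.2 (Set.mem_univ x) (Set.mem_univ y) ha hb hab)).trans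
      (convexOn_exp.2 (Set.mem_univ _) (Set.mem_univ _) ha hb hab)⟩

/-- The trapezoidal rule overestimates the integral of the convex function `exp (x ^ 2)`. -/
theorem expSqIntegral_sub_le {p q : ℝ} (h : q ≤ p) :
    expSqIntegral p - expSqIntegral q ≤
      (p - q) / 2 * (Real.exp (p ^ 2) + Real.exp (q ^ 2)) := by
  rcases h.eq_or_lt with rfl | h
  · simp
  -- `s` is the slope of the chord of exp(x²) over [q, p]. The integral minus the primitive of the
  -- chord is antitone there, because a convex function lies below its chord.
  set s := (Real.exp (p ^ 2) - Real.exp (q ^ 2)) / (p - q) with hs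
  have hpq : p - q ≠ 0 := by linarith
  have hmono : AntitoneOn (fun x => expSqIntegral x -
      (Real.exp (q ^ 2) * (x - q) + s * (x - q) ^ 2 / 2)) (Set.Icc q p) := by
    have hd (x : ℝ) : HasDerivAt (fun x => expSqIntegral x -
        (Real.exp (q ^ 2) * (x - q) + s * (x - q) ^ 2 / 2))
        (Real.exp (x ^ 2) - (Real.exp (q ^ 2) + s * (x - q))) x := by
      have h1 := (hasDerivAt_id x).sub_const q
      refine ((hasDerivAt_expSqIntegral x).sub ((h1.const_mul (Real.exp (q ^ 2))).add
        (((h1.pow 2).const_mul s).div_const 2))).congr_deriv ?_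
      simp
      ring
    refine antitoneOn_of_deriv_nonpos (convex_Icc q p)
      (fun x _ => (hd x).continuousAt.continuousWithinAt)
      (fun x _ => (hd x).differentiableAt.differentiableWithinAt) fun x hx => ?_
    rw [interior_Icc] at hx
    rw [(hd x).deriv]
    have hc := convexOn_exp_sq.2 (Set.mem_univ p) (Set.mem_univ q)
      (div_nonneg (sub_nonneg.2 hx.1.le) (sub_nonneg.2 h.le))
      (div_nonneg (sub_nonneg.2 hx.2.le) (sub_nonneg.2 h.le)) (by field_simp; ring)
    have e1 : ((x - q) / (p - q)) • p + ((p - x) / (p - q)) • q = x := by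
      simp only [smul_eq_mul]; field_simp; ring
    have e2 : ((x - q) / (p - q)) • Real.exp (p ^ 2) + ((p - x) / (p - q)) • Real.exp (q ^ 2)
        = Real.exp (q ^ 2) + s * (x - q) := by
      simp only [smul_eq_mul, hs]; field_simp; ring
    simp only [e1, e2] at hc
    linarith
  have := hmono (Set.left_mem_Icc.2 h.le) (Set.right_mem_Icc.2 h.le) h.le
  simp only [sub_self] at this
  have e : s * (p - q) ^ 2 / 2 = (Real.exp (p ^ 2) - Real.exp (q ^ 2)) * (p - q) / 2 := by
    rw [hs]; field_simp
  rw [e] at this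
  linarith

/-- The increment of the integral over an interval of length `k` to the right of `y ≥ 0`. -/
theorem mul_exp_sq_le_expSqIntegral {y k : ℝ} (hy : 0 ≤ y) (hk : 0 ≤ k) :
    k * Real.exp (y ^ 2) ≤ expSqIntegral (y + k) := by
  have hmono : MonotoneOn (fun x => expSqIntegral x - Real.exp (y ^ 2) * x) (Set.Ici y) := by
    have hd (x : ℝ) : HasDerivAt (fun x => expSqIntegral x - Real.exp (y ^ 2) * x)
        (Real.exp (x ^ 2) - Real.exp (y ^ 2)) x := by
      refine ((hasDerivAt_expSqIntegral x).sub
        ((hasDerivAt_id x).const_mul (Real.exp (y ^ 2)))).congr_deriv ?_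
      simp
    refine monotoneOn_of_deriv_nonneg (convex_Ici y)
      (fun x _ => (hd x).continuousAt.continuousWithinAt)
      (fun x _ => (hd x).differentiableAt.differentiableWithinAt) fun x hx => ?_
    rw [interior_Ici] at hx
    rw [(hd x).deriv, sub_nonneg, Real.exp_le_exp]
    exact pow_le_pow_left₀ hy hx.le 2
  have h1 := hmono Set.self_mem_Ici (Set.mem_Ici.2 (by linarith : y ≤ y + k)) (by linarith)
  have h2 := monotone_expSqIntegral hy
  rw [expSqIntegral_zero] at h2
  simp only at h1
  linarith

/-! ### The potential and the discrete heat inequality -/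

theorem potentialHalf_eq (C t S : ℝ) :
    potentialHalf C t S = C * √t * (2 * expSqDoubleIntegral (S / √(2 * t)) - 1) := rfl

theorem neg_mul_sqrt_le_potentialHalf {C : ℝ} (hC : 0 < C) (t S : ℝ) :
    -(C * √t) ≤ potentialHalf C t S := by
  have := mul_nonneg (mul_nonneg hC.le (Real.sqrt_nonneg t))
    (expSqDoubleIntegral_nonneg (S / √(2 * t)))
  rw [potentialHalf_eq]
  linarith

/-- Convexity in S: the right side is the chord through S ± 1 evaluated at S - c. Its slope is the
coefficient `y_t` of the algorithm, so the last term is exactly the loss of the round. -/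
theorem potentialHalf_sub_le {C : ℝ} (hC : 0 < C) (t S : ℝ) {c : ℝ} (hc : |c| ≤ 1) :
    potentialHalf C t (S - c) ≤ (potentialHalf C t (S + 1) + potentialHalf C t (S - 1)) / 2
      - c * ((potentialHalf C t (S + 1) - potentialHalf C t (S - 1)) / 2) := by
  obtain ⟨h1, h2⟩ := abs_le.1 hc
  have h := convexOn_expSqDoubleIntegral.2 (Set.mem_univ ((S + 1) / √(2 * t)))
    (Set.mem_univ ((S - 1) / √(2 * t))) (by linarith : 0 ≤ (1 - c) / 2)
    (by linarith : 0 ≤ (1 + c) / 2) (by ring)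
  have e : ((1 - c) / 2) • ((S + 1) / √(2 * t)) + ((1 + c) / 2) • ((S - 1) / √(2 * t))
      = (S - c) / √(2 * t) := by
    simp only [smul_eq_mul]; ring
  rw [e] at h
  simp only [smul_eq_mul] at h
  have := mul_le_mul_of_nonneg_left h (mul_nonneg hC.le (Real.sqrt_nonneg t))
  simp only [potentialHalf_eq]
  linarith

/-- Derivative of the potential along a parabola: the backward heat equation leaves only the
contribution of the first-order terms. -/
theorem hasDerivAt_potentialHalf_parabola (C S : ℝ) {τ : ℝ} (hτ : 0 < τ) (a : ℝ) :
    HasDerivAt (fun a => potentialHalf C (τ + a ^ 2) (S + a))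
      (C * (√2 * expSqIntegral ((S + a) / √(2 * (τ + a ^ 2)))
        - a / √(τ + a ^ 2) * Real.exp (((S + a) / √(2 * (τ + a ^ 2))) ^ 2))) a := by
  have hpos : 0 < τ + a ^ 2 := by positivity
  have hr : HasDerivAt (fun a => √(τ + a ^ 2)) (a / √(τ + a ^ 2)) a := by
    refine ((((hasDerivAt_id a).pow 2).const_add τ).sqrt (by simpa using hpos.ne')).congr_deriv ?_
    simp
    field_simp
  have hrp : 0 < √(τ + a ^ 2) := Real.sqrt_pos.2 hpos
  have hz := ((hasDerivAt_id a).const_add S).div (hr.const_mul √2) (by positivity)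
  have hF := (((hasDerivAt_expSqDoubleIntegral _).comp a hz).const_mul 2).sub_const 1
  have hV := (hr.mul hF).const_mul C
  have e (b : ℝ) : √(2 * (τ + b ^ 2)) = √2 * √(τ + b ^ 2) := Real.sqrt_mul (by norm_num) _
  have h2 : √2 * √2 = (2 : ℝ) := Real.mul_self_sqrt (by norm_num)
  have h2p : 0 < √(2 : ℝ) := by positivity
  have hfun : (fun a => potentialHalf C (τ + a ^ 2) (S + a)) = fun b =>
      C * (√(τ + b ^ 2) * (2 * expSqDoubleIntegral ((S + b) / (√2 * √(τ + b ^ 2))) - 1)) := by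
    funext b
    rw [potentialHalf_eq, e, mul_assoc C]
  rw [hfun]
  refine hV.congr_deriv ?_
  have hI := two_mul_expSqDoubleIntegral ((S + a) / (√2 * √(τ + a ^ 2)))
  simp only [e, Function.comp, Pi.div_apply, id, one_mul]
  rw [hI]
  generalize √(τ + a ^ 2) = r at *
  generalize hx : Real.exp (((S + a) / (√2 * r)) ^ 2) = x
  generalize expSqIntegral ((S + a) / (√2 * r)) = g
  field_simp
  linear_combination (-C * r ^ 2 * g) * h2

/-- The potential is a supersolution of the discrete backward heat equation. -/
theorem potentialHalf_heat_step {C : ℝ} (hC : 0 < C) (S : ℝ) {τ : ℝ} (hτ : 0 < τ) :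
    (potentialHalf C (τ + 1) (S + 1) + potentialHalf C (τ + 1) (S - 1)) / 2
      ≤ potentialHalf C τ S := by
  -- V(τ + a², S + a) + V(τ + a², S - a) interpolates between 2V(τ, S) at a = 0 and the sum at time
  -- τ + 1 at a = 1. The trapezoidal estimate makes its derivative nonpositive.
  have hd (a : ℝ) := (hasDerivAt_potentialHalf_parabola C S hτ a).add
    ((hasDerivAt_potentialHalf_parabola C S hτ (-a)).comp a (hasDerivAt_neg a))
  have hanti := antitoneOn_of_deriv_nonpos (convex_Icc (0 : ℝ) 1)
      (fun x _ => (hd x).continuousAt.continuousWithinAt)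
      (fun x _ => (hd x).differentiableAt.differentiableWithinAt) fun a ha => by
    rw [interior_Icc] at ha
    rw [(hd a).deriv]
    have hpos : 0 < τ + a ^ 2 := by positivity
    have hrp : 0 < √(τ + a ^ 2) := Real.sqrt_pos.2 hpos
    have h2p : 0 < √(2 : ℝ) := by positivity
    have h2 : √2 * √2 = (2 : ℝ) := Real.mul_self_sqrt (by norm_num)
    have e : √(2 * (τ + a ^ 2)) = √2 * √(τ + a ^ 2) := Real.sqrt_mul (by norm_num) _
    simp only [neg_sq]
    have hle := expSqIntegral_sub_le (p := (S + a) / √(2 * (τ + a ^ 2)))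
      (q := (S + -a) / √(2 * (τ + a ^ 2)))
      (div_le_div_of_nonneg_right (by linarith [ha.1]) (Real.sqrt_nonneg _))
    have hw : √2 * (((S + a) / √(2 * (τ + a ^ 2)) - (S + -a) / √(2 * (τ + a ^ 2))) / 2)
        = a / √(τ + a ^ 2) := by
      rw [e]; field_simp; ring
    have := mul_le_mul_of_nonneg_left (mul_le_mul_of_nonneg_left hle h2p.le) hC.le
    rw [← mul_assoc √2 (_ / 2), hw] at this
    linear_combination this
  have := hanti (Set.left_mem_Icc.2 zero_le_one) (Set.right_mem_Icc.2 zero_le_one) zero_le_one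
  simp at this
  rw [← sub_eq_add_neg] at this
  linarith

/-! ### Projected online gradient descent -/

variable {d : ℕ}

theorem norm_lossGradient_le (A : Algorithm d) (adv : Adversary d) (t : ℕ) :
    ‖lossGradient A adv t‖ ≤ 1 :=
  mem_closedBall_zero_iff.1 (history A adv (t + 1) (Fin.last t)).2

theorem init_history (A : Algorithm d) (adv : Adversary d) (t : ℕ) :
    Fin.init (history A adv (t + 1)) = history A adv t := by
  simp only [history]
  exact Fin.init_snoc (α := fun _ => Gradient d) _ _

theorem norm_projBall_le (v : E d) : ‖projBall v‖ ≤ 1 := by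
  have h : 0 < max 1 ‖v‖ := lt_max_of_lt_left one_pos
  rw [projBall, norm_smul, norm_inv, Real.norm_eq_abs, abs_of_pos h, inv_mul_le_iff₀ h, mul_one]
  exact le_max_right _ _

theorem norm_ogd_le (t : ℕ) (g : Fin t → Gradient d) : ‖ogd t g‖ ≤ 1 := by
  cases t with
  | zero => simp [ogd]
  | succ t => exact norm_projBall_le _

/-- The projection onto the unit ball does not increase the distance to points of the ball. -/
theorem norm_projBall_sub_sq_le (w : E d) {v : E d} (hv : ‖v‖ ≤ 1) :
    ‖projBall w - v‖ ^ 2 ≤ ‖w - v‖ ^ 2 := by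
  rcases le_or_gt ‖w‖ 1 with h | h
  · simp [projBall, max_eq_left h]
  have hw : w = ‖w‖ • projBall w := by
    rw [projBall, max_eq_right h.le, smul_smul, mul_inv_cancel₀ (by positivity), one_smul]
  have hp : ‖projBall w‖ = 1 := by
    rw [projBall, max_eq_right h.le, norm_smul, norm_inv, norm_norm,
      inv_mul_cancel₀ (by positivity)]
  set p := projBall w
  set n := ‖w‖
  have hpv : inner ℝ p v ≤ 1 := by
    have := real_inner_le_norm p v
    rw [hp, one_mul] at this
    exact this.trans hv
  rw [hw, norm_sub_sq_real, norm_sub_sq_real, norm_smul, hp, real_inner_smul_left,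
    Real.norm_eq_abs, mul_one, sq_abs]
  -- The difference of the two sides is (n - 1)² + 2(n - 1)(1 - ⟪p, v⟫).
  nlinarith [mul_nonneg (sub_nonneg.2 h.le) (sub_nonneg.2 hpv), sq_nonneg (n - 1)]

/-- One step of online gradient descent. -/
theorem inner_ogd_sub_le (A : Algorithm d) (adv : Adversary d) (t : ℕ) {v : E d} (hv : ‖v‖ ≤ 1) :
    inner ℝ (lossGradient A adv t) (ogd t (history A adv t) - v) ≤
      √((t : ℝ) + 1) / 2 * (‖ogd t (history A adv t) - v‖ ^ 2
        - ‖ogd (t + 1) (history A adv (t + 1)) - v‖ ^ 2) + 1 / (2 * √((t : ℝ) + 1)) := by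
  have hr : 0 < √((t : ℝ) + 1) := Real.sqrt_pos.2 (by positivity)
  have hstep : ogd (t + 1) (history A adv (t + 1)) = projBall (ogd t (history A adv t) -
      (1 / √((t : ℝ) + 1)) • lossGradient A adv t) := by
    rw [ogd, init_history, lossGradient]
  have h1 := norm_projBall_sub_sq_le (ogd t (history A adv t) -
      (1 / √((t : ℝ) + 1)) • lossGradient A adv t) hv
  rw [← hstep, sub_right_comm, norm_sub_sq_real (_ - v) (_ • _), real_inner_smul_right, norm_smul,
    real_inner_comm] at h1
  have hg : (‖1 / √((t : ℝ) + 1)‖ * ‖lossGradient A adv t‖) ^ 2 ≤ (1 / √((t : ℝ) + 1)) ^ 2 := by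
    rw [Real.norm_of_nonneg (by positivity)]
    exact pow_le_pow_left₀ (by positivity)
      (mul_le_of_le_one_right (by positivity) (norm_lossGradient_le A adv t)) 2
  have h2 := mul_le_mul_of_nonneg_left (h1.trans (add_le_add_right hg _))
    (by positivity : 0 ≤ √((t : ℝ) + 1) / 2)
  generalize √((t : ℝ) + 1) = r at *
  have e : r / 2 * (‖ogd t (history A adv t) - v‖ ^ 2 -
      2 * (1 / r * inner ℝ (lossGradient A adv t) (ogd t (history A adv t) - v)) + (1 / r) ^ 2)
      = r / 2 * ‖ogd t (history A adv t) - v‖ ^ 2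
        - inner ℝ (lossGradient A adv t) (ogd t (history A adv t) - v) + 1 / (2 * r) := by
    field_simp
  rw [e] at h2
  linarith

/-- The regret of online gradient descent on the unit ball. -/
theorem ogd_regret_le (A : Algorithm d) (adv : Adversary d) (T : ℕ) {v : E d} (hv : ‖v‖ ≤ 1) :
    ∑ t ∈ Finset.range T, inner ℝ (lossGradient A adv t) (ogd t (history A adv t) - v)
      ≤ 3 * √(T : ℝ) := by
  -- The distance term is kept so that the induction telescopes. With Δ = √(T+1) - √T, the growing
  -- weight costs at most 2Δ (squared distances are at most 4) and the gradient term at most Δ,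
  -- hence the constant 3.
  have key : ∑ t ∈ Finset.range T, inner ℝ (lossGradient A adv t) (ogd t (history A adv t) - v)
      + √(T : ℝ) / 2 * ‖ogd T (history A adv T) - v‖ ^ 2 ≤ 3 * √(T : ℝ) := by
    induction T with
    | zero => simp
    | succ T ih =>
      rw [Finset.sum_range_succ]
      have h1 := inner_ogd_sub_le A adv T hv
      push_cast
      have hD : ‖ogd T (history A adv T) - v‖ ^ 2 ≤ 4 := by
        have := norm_sub_le (ogd T (history A adv T)) v
        have := norm_ogd_le T (history A adv T)
        nlinarith [norm_nonneg (ogd T (history A adv T) - v)]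
      have ha : 0 < √((T : ℝ) + 1) := Real.sqrt_pos.2 (by positivity)
      have hab : √(T : ℝ) ≤ √((T : ℝ) + 1) := Real.sqrt_le_sqrt (by linarith)
      have hb := Real.sqrt_nonneg (T : ℝ)
      have hsq : √((T : ℝ) + 1) ^ 2 - √(T : ℝ) ^ 2 = 1 := by
        rw [Real.sq_sqrt (by positivity), Real.sq_sqrt (by positivity)]; ring
      have hinc : 1 / (2 * √((T : ℝ) + 1)) ≤ √((T : ℝ) + 1) - √(T : ℝ) := by
        rw [div_le_iff₀ (by positivity)]
        nlinarith
      nlinarith [mul_nonneg (sub_nonneg.2 hab) (sub_nonneg.2 hD)]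
  have : 0 ≤ √(T : ℝ) / 2 * ‖ogd T (history A adv T) - v‖ ^ 2 := by positivity
  linarith

/-! ### Loss and regret of the algorithm -/

theorem statistic_history_succ (A : Algorithm d) (adv : Adversary d) (t : ℕ) :
    statistic (t + 1) (history A adv (t + 1)) = statistic t (history A adv t)
      - inner ℝ (lossGradient A adv t) (ogd t (history A adv t)) := by
  rw [statistic, init_history, lossGradient]

theorem statistic_history (A : Algorithm d) (adv : Adversary d) (T : ℕ) :
    statistic T (history A adv T) =
      -∑ t ∈ Finset.range T, inner ℝ (lossGradient A adv t) (ogd t (history A adv t)) := by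
  induction T with
  | zero => simp [statistic]
  | succ T ih => rw [statistic_history_succ, ih, Finset.sum_range_succ]; ring

/-- The cumulative loss of `A_{1/2}` is controlled by the potential. -/
theorem algorithmHalf_loss_le {C : ℝ} (hC : 0 < C) (adv : Adversary d) (T : ℕ) :
    ∑ t ∈ Finset.range (T + 1), inner ℝ (lossGradient (algorithmHalf d C) adv t)
        (prediction (algorithmHalf d C) adv t)
      ≤ -C - potentialHalf C ((T : ℝ) + 1)
        (statistic (T + 1) (history (algorithmHalf d C) adv (T + 1))) := by
  induction T with
  | zero =>
    -- The induction starts after the first round, since the heat inequality needs τ > 0. That round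
    -- has z = 0, hence no loss and S still 0, and V(1, 0) = -C.
    have h0 : statistic 1 (history (algorithmHalf d C) adv 1) = 0 := by
      rw [statistic_history_succ]; simp [statistic, ogd]
    rw [zero_add, h0]
    simp [prediction, algorithmHalf, potentialAlgorithm, ogd, potentialHalf_eq,
      expSqDoubleIntegral_zero]
  | succ T ih =>
    rw [Finset.sum_range_succ, statistic_history_succ]
    set A := algorithmHalf d C with hA
    set S := statistic (T + 1) (history A adv (T + 1)) with hS
    set c := inner ℝ (lossGradient A adv (T + 1)) (ogd (T + 1) (history A adv (T + 1))) with hc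
    have hc1 : |c| ≤ 1 := (abs_real_inner_le_norm _ _).trans
      (mul_le_one₀ (norm_lossGradient_le A adv _) (norm_nonneg _) (norm_ogd_le _ _))
    have hx : inner ℝ (lossGradient A adv (T + 1)) (prediction A adv (T + 1)) =
        c * ((potentialHalf C ((T : ℝ) + 1 + 1) (S + 1)
          - potentialHalf C ((T : ℝ) + 1 + 1) (S - 1)) / 2) := by
      rw [prediction]
      conv_lhs => rw [hA, algorithmHalf, potentialAlgorithm, ← algorithmHalf, ← hA]
      rw [real_inner_smul_right, ← hc, ← hS, mul_comm]
      push_cast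
      rfl
    rw [hx]
    push_cast
    have h1 := potentialHalf_sub_le hC ((T : ℝ) + 1 + 1) S hc1
    have h2 := potentialHalf_heat_step hC S (by positivity : (0 : ℝ) < (T : ℝ) + 1)
    linarith

theorem regret_zero (A : Algorithm d) (adv : Adversary d) (T : ℕ) :
    regret A adv T 0 =
      ∑ t ∈ Finset.range T, inner ℝ (lossGradient A adv t) (prediction A adv t) := by
  simp [regret]

theorem algorithmHalf_regret_zero_le {C : ℝ} (hC : 0 < C) (adv : Adversary d) {T : ℕ}
    (hT : 0 < T) : regret (algorithmHalf d C) adv T 0 ≤ C * √(T : ℝ) := by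
  obtain ⟨T, rfl⟩ := Nat.exists_eq_add_of_lt hT
  rw [zero_add, regret_zero]
  have h1 := algorithmHalf_loss_le hC adv T
  have h2 := neg_mul_sqrt_le_potentialHalf hC ((T : ℝ) + 1)
    (statistic (T + 1) (history (algorithmHalf d C) adv (T + 1)))
  push_cast
  linarith

/-- The convex conjugate of the potential at `U`. -/
theorem mul_sub_potentialHalf_le {C U t : ℝ} (hC : 0 < C) (hU : 1 ≤ U) (ht : 0 < t) (S : ℝ) :
    U * S - potentialHalf C t S ≤ √t * (√2 * U * (√(Real.log U) + 1 / (√2 * C)) + C) := by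
  have h2p : 0 < √(2 : ℝ) := by positivity
  have h2 : √2 * √2 = (2 : ℝ) := Real.mul_self_sqrt (by norm_num)
  have htp : 0 < √t := Real.sqrt_pos.2 ht
  -- exp(y²) = U at y = √(log U), and √2·C·k = 1. Hence the slope of 2C times the double integral at
  -- y + k is at least 2CkU = √2·U, and moving beyond y + k gains nothing.
  set k := 1 / (√2 * C) with hk
  have hk0 : 0 < k := by positivity
  set z := S / √(2 * t) with hz
  have hS : S = √2 * √t * z := by
    rw [hz, Real.sqrt_mul (by norm_num)]; field_simp
  have hG := mul_exp_sq_le_expSqIntegral (Real.sqrt_nonneg (Real.log U)) hk0.le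
  rw [Real.sq_sqrt (Real.log_nonneg hU), Real.exp_log (by linarith)] at hG
  have main : √2 * U * z - 2 * C * expSqDoubleIntegral z ≤ √2 * U * (√(Real.log U) + k) := by
    rcases le_total z (√(Real.log U) + k) with h | h
    · have h1 := mul_le_mul_of_nonneg_left h (by positivity : 0 ≤ √2 * U)
      have h3 := mul_nonneg (by positivity : 0 ≤ 2 * C) (expSqDoubleIntegral_nonneg z)
      linarith
    · have h1 := expSqDoubleIntegral_tangent_le (√(Real.log U) + k) z
      have h3 := expSqDoubleIntegral_nonneg (√(Real.log U) + k)
      have h4 := mul_le_mul_of_nonneg_right hG (sub_nonneg.2 h)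
      have h5 := mul_le_mul_of_nonneg_left (h4.trans (by linarith :
        _ ≤ expSqDoubleIntegral z)) (by positivity : 0 ≤ 2 * C)
      have e : 2 * C * (k * U * (z - (√(Real.log U) + k)))
          = √2 * U * (z - (√(Real.log U) + k)) := by
        have hkC : √2 * C * k = 1 := by rw [hk]; field_simp
        linear_combination (√2 * U * (z - (√(Real.log U) + k))) * hkC
          - (C * k * U * (z - (√(Real.log U) + k))) * h2
      linarith
  have := mul_le_mul_of_nonneg_left main htp.le
  rw [potentialHalf_eq, ← hz, hS]
  linarith

/-- With v = u/‖u‖, the comparator term -∑⟪g, u⟫ equals ‖u‖ times the gradient-descent regret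
against v plus ‖u‖·S. The loss bound turns the remainder into ‖u‖·S - V, which the conjugate bounds.
-/
theorem algorithmHalf_regret_le {C : ℝ} (hC : 0 < C) (adv : Adversary d) {T : ℕ} (hT : 0 < T)
    {u : E d} (hu : 1 ≤ ‖u‖) :
    regret (algorithmHalf d C) adv T u ≤
      √(T : ℝ) * (√2 * ‖u‖ * (√(Real.log ‖u‖) + 1 / (√2 * C)) + C + 3 * ‖u‖) := by
  obtain ⟨T, rfl⟩ := Nat.exists_eq_add_of_lt hT
  rw [zero_add]
  set A := algorithmHalf d C
  have hu0 : 0 < ‖u‖ := by linarith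
  have hv : ‖‖u‖⁻¹ • u‖ ≤ 1 := by
    rw [norm_smul, norm_inv, norm_norm, inv_mul_cancel₀ hu0.ne']
  have h1 := algorithmHalf_loss_le hC adv T
  have h2 := ogd_regret_le A adv (T + 1) hv
  have h3 := mul_sub_potentialHalf_le hC hu (by positivity : (0 : ℝ) < (T : ℝ) + 1)
    (statistic (T + 1) (history A adv (T + 1)))
  have h4 := statistic_history A adv (T + 1)
  simp only [inner_sub_right, Finset.sum_sub_distrib, real_inner_smul_right,
    ← Finset.mul_sum] at h2
  have h5 := mul_le_mul_of_nonneg_left h2 hu0.le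
  rw [mul_sub, mul_inv_cancel_left₀ hu0.ne', ← neg_neg (∑ t ∈ _, inner ℝ _ (ogd t _)), ← h4] at h5
  push_cast at h5 ⊢
  rw [regret]
  linarith

theorem worstRatio_algorithmHalf_le {C : ℝ} (hC : 0 < C) {U : ℝ} (hU : 1 < U) {T : ℕ}
    (hT : 0 < T) :
    worstRatio (algorithmHalf d C) U T ≤
      ((√2 + (1 / C + C + 3) / √(Real.log U) : ℝ) : EReal) := by
  refine iSup_le fun u => iSup_le fun hu => iSup_le fun adv => EReal.coe_le_coe_iff.2 ?_
  have hL : 0 < √(Real.log U) := Real.sqrt_pos.2 (Real.log_pos hU)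
  have hTp : 0 < √(T : ℝ) := Real.sqrt_pos.2 (by positivity)
  have h := algorithmHalf_regret_le hC adv hT (hu ▸ hU.le : 1 ≤ ‖u‖)
  rw [hu] at h ⊢
  have hU0 : 0 < U := by linarith
  rw [Real.sqrt_mul (by positivity), div_le_iff₀ (by positivity)]
  refine h.trans ?_
  have e : (√2 + (1 / C + C + 3) / √(Real.log U)) * (U * (√(T : ℝ) * √(Real.log U)))
      = √(T : ℝ) * (√2 * U * √(Real.log U) + U / C + C * U + 3 * U) := by
    field_simp
    ring
  have e2 : √2 * U * (√(Real.log U) + 1 / (√2 * C)) = √2 * U * √(Real.log U) + U / C := by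
    field_simp
  rw [e, e2]
  have : C ≤ C * U := le_mul_of_one_le_right hC.le hU.le
  exact mul_le_mul_of_nonneg_left (by linarith) hTp.le

theorem tendsto_const_div_sqrt_log (K : ℝ) :
    Filter.Tendsto (fun U : ℝ => K / √(Real.log U)) Filter.atTop (nhds 0) :=
  Filter.Tendsto.const_div_atTop (Real.tendsto_sqrt_atTop.comp Real.tendsto_log_atTop) K

theorem limsup_worstRatio_algorithmHalf_le {C : ℝ} (hC : 0 < C) :
    Filter.limsup (fun U : ℝ =>
        Filter.limsup (fun T : ℕ => worstRatio (algorithmHalf d C) U T) Filter.atTop)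
      Filter.atTop ≤ ((√2 : ℝ) : EReal) := by
  have ht : Filter.Tendsto
      (fun U : ℝ => ((√2 + (1 / C + C + 3) / √(Real.log U) : ℝ) : EReal))
      Filter.atTop (nhds ((√2 : ℝ) : EReal)) := by
    refine (continuous_coe_real_ereal.tendsto _).comp ?_
    simpa using (tendsto_const_div_sqrt_log (1 / C + C + 3)).const_add √2
  rw [← ht.limsup_eq]
  refine Filter.limsup_le_limsup ?_
  filter_upwards [Filter.eventually_gt_atTop 1] with U hU
  refine Filter.limsup_le_of_le (h := ?_)
  filter_upwards [Filter.eventually_gt_atTop 0] with T hT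
  exact worstRatio_algorithmHalf_le hC hU hT

/-! ### Oblivious adversaries and random walks -/

/-- The adversary that plays a fixed sequence of gradients. -/
def obliviousAdversary (g : ℕ → Gradient d) : Adversary d := fun t _ => g t

theorem history_obliviousAdversary (A : Algorithm d) (g : ℕ → Gradient d) (t : ℕ) :
    history A (obliviousAdversary g) t = fun i : Fin t => g i := by
  induction t with
  | zero => exact funext fun i => i.elim0
  | succ t ih =>
    funext i
    rw [history, ih]
    refine Fin.lastCases ?_ (fun j => ?_) i
    · simp [obliviousAdversary]
    · simp

theorem lossGradient_obliviousAdversary (A : Algorithm d) (g : ℕ → Gradient d) (t : ℕ) :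
    lossGradient A (obliviousAdversary g) t = g t := by
  rw [lossGradient, history_obliviousAdversary]; rfl

theorem prediction_obliviousAdversary (A : Algorithm d) (g : ℕ → Gradient d) (t : ℕ) :
    prediction A (obliviousAdversary g) t = A t fun i : Fin t => g i := by
  rw [prediction, history_obliviousAdversary]

/-- If `Φ` is a martingale for the simple random walk, there is a walk along which the loss of
the algorithm plus the terminal value of `Φ` is at least the initial value of `Φ`. -/
theorem exists_gradients_le_loss_add (A : Algorithm d) {e : E d} (he : ‖e‖ = 1) (Φ : ℕ → ℝ → ℝ)
    (T : ℕ) (hΦ : ∀ t < T, ∀ S, Φ t S = (Φ (t + 1) (S + 1) + Φ (t + 1) (S - 1)) / 2) :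
    ∃ g : ℕ → Gradient d,
      Φ 0 0 ≤ ∑ t ∈ Finset.range T, inner ℝ (g t : E d) (A t fun i : Fin t => g i)
        + Φ T (-∑ t ∈ Finset.range T, inner ℝ (g t : E d) e) := by
  have hee : inner ℝ e e = 1 := by rw [real_inner_self_eq_norm_sq, he, one_pow]
  induction T with
  | zero => exact ⟨fun _ => ⟨0, by simp⟩, by simp⟩
  | succ T ih =>
    obtain ⟨g, hg⟩ := ih fun t ht => hΦ t (ht.trans T.lt_succ_self)
    set S := -∑ t ∈ Finset.range T, inner ℝ (g t : E d) e with hS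
    set p := inner ℝ e (A T fun i : Fin T => g i) with hp
    rw [hΦ T T.lt_succ_self] at hg
    have upd (x : Gradient d) :
        ∑ t ∈ Finset.range (T + 1), inner ℝ (Function.update g T x t : E d)
            (A t fun i : Fin t => Function.update g T x i)
          = ∑ t ∈ Finset.range T, inner ℝ (g t : E d) (A t fun i : Fin t => g i)
            + inner ℝ (x : E d) (A T fun i : Fin T => g i) ∧
        -∑ t ∈ Finset.range (T + 1), inner ℝ (Function.update g T x t : E d) e
          = S - inner ℝ (x : E d) e := by
      have hne {t : ℕ} (ht : t ≤ T) : (fun i : Fin t => Function.update g T x i)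
          = fun i : Fin t => g i :=
        funext fun i => Function.update_of_ne (i.isLt.trans_le ht).ne _ _
      constructor
      · rw [Finset.sum_range_succ, Function.update_self, hne le_rfl]
        congr 1
        refine Finset.sum_congr rfl fun t ht => ?_
        rw [Finset.mem_range] at ht
        rw [hne ht.le, Function.update_of_ne ht.ne]
      · rw [Finset.sum_range_succ, Function.update_self, neg_add, ← sub_eq_add_neg]
        congr 2
        refine Finset.sum_congr rfl fun t ht => ?_
        rw [Function.update_of_ne (Finset.mem_range.1 ht).ne]
    -- The prediction is fixed before the last gradient, so its contribution ±p cancels in the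
    -- average over the gradients ±e. The better sign does at least as well as the average.
    rcases le_total (-p + Φ (T + 1) (S + 1)) (p + Φ (T + 1) (S - 1)) with h | h
    · refine ⟨Function.update g T ⟨e, by simp [he]⟩, ?_⟩
      rw [(upd _).1, (upd _).2, hee, ← hp]
      linarith
    · refine ⟨Function.update g T ⟨-e, by simp [he]⟩, ?_⟩
      rw [(upd _).1, (upd _).2, inner_neg_left, inner_neg_left, hee, ← hp, sub_neg_eq_add]
      linarith

/-! ### Exponential and bump martingales -/

/-- The exponential martingale of the simple random walk of `T` steps, scaled by `1 / √T`. -/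
def expMartingale (T : ℕ) (μ : ℝ) (t : ℕ) (S : ℝ) : ℝ :=
  Real.exp (μ / √(T : ℝ) * S) * Real.cosh (μ / √(T : ℝ)) ^ (T - t)

theorem expMartingale_step (T : ℕ) (μ : ℝ) {t : ℕ} (ht : t < T) (S : ℝ) :
    expMartingale T μ t S =
      (expMartingale T μ (t + 1) (S + 1) + expMartingale T μ (t + 1) (S - 1)) / 2 := by
  obtain ⟨k, rfl⟩ := Nat.exists_eq_add_of_lt ht
  have h1 : t + k + 1 - t = k + 1 := by omega
  have h2 : t + k + 1 - (t + 1) = k := by omega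
  rw [expMartingale, expMartingale, expMartingale, h1, h2, pow_succ]
  generalize μ / √((t + k + 1 : ℕ) : ℝ) = m
  rw [mul_add, mul_sub, mul_one, Real.exp_add, Real.exp_sub, Real.cosh_eq, Real.exp_neg]
  ring

theorem one_add_sq_div_two_le_cosh (x : ℝ) : 1 + x ^ 2 / 2 ≤ Real.cosh x := by
  have h : Real.cosh x = 1 + 2 * Real.sinh (x / 2) ^ 2 := by
    have h1 := Real.cosh_two_mul (x / 2)
    have h2 := Real.cosh_sq (x / 2)
    rw [mul_div_cancel₀ x (two_ne_zero)] at h1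
    linarith
  have h3 : (x / 2) ^ 2 ≤ Real.sinh (x / 2) ^ 2 := by
    rw [sq_le_sq]
    rcases le_total 0 (x / 2) with h0 | h0
    · rw [abs_of_nonneg h0, abs_of_nonneg (Real.sinh_nonneg_iff.2 h0)]
      exact Real.self_le_sinh_iff.2 h0
    · rw [abs_of_nonpos h0, abs_of_nonpos (Real.sinh_nonpos_iff.2 h0)]
      exact neg_le_neg (Real.sinh_le_self_iff.2 h0)
  linarith

/-- The value is cosh(μ/√T)^T, squeezed by 1 + x²/2 ≤ cosh x ≤ exp(x²/2). This stands in for the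
central limit theorem. -/
theorem tendsto_expMartingale (μ : ℝ) :
    Filter.Tendsto (fun T : ℕ => expMartingale T μ 0 0) Filter.atTop
      (nhds (Real.exp (μ ^ 2 / 2))) := by
  refine tendsto_of_tendsto_of_tendsto_of_le_of_le'
    (Real.tendsto_one_add_div_pow_exp (μ ^ 2 / 2)) tendsto_const_nhds ?_ ?_
  · filter_upwards with T
    rw [expMartingale, mul_zero, Real.exp_zero, one_mul, Nat.sub_zero]
    refine pow_le_pow_left₀ (by positivity) ?_ T
    refine le_trans (le_of_eq ?_) (one_add_sq_div_two_le_cosh _)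
    rw [div_pow, Real.sq_sqrt (by positivity)]
    ring
  · filter_upwards [Filter.eventually_gt_atTop 0] with T hT
    rw [expMartingale, mul_zero, Real.exp_zero, one_mul, Nat.sub_zero]
    refine (pow_le_pow_left₀ (Real.cosh_pos _).le (Real.cosh_le_exp_half_sq _) T).trans
      (le_of_eq ?_)
    have : (T : ℝ) ≠ 0 := by positivity
    rw [← Real.exp_nat_mul, div_pow, Real.sq_sqrt (by positivity)]
    congr 1
    field_simp

/-- A martingale of the simple random walk whose terminal value
`exp (l x - l ^ 2 / 2) * (2 - cosh (x - l))`, `x = S / √T`, is positive only for `x` near `l`. -/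
def bumpMartingale (T : ℕ) (l : ℝ) (t : ℕ) (S : ℝ) : ℝ :=
  2 * Real.exp (-l ^ 2 / 2) * expMartingale T l t S
    - Real.exp (-l ^ 2 / 2 - l) / 2 * expMartingale T (l + 1) t S
    - Real.exp (-l ^ 2 / 2 + l) / 2 * expMartingale T (l - 1) t S

theorem bumpMartingale_step (T : ℕ) (l : ℝ) {t : ℕ} (ht : t < T) (S : ℝ) :
    bumpMartingale T l t S =
      (bumpMartingale T l (t + 1) (S + 1) + bumpMartingale T l (t + 1) (S - 1)) / 2 := by
  simp only [bumpMartingale, expMartingale_step T _ ht S]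
  ring

theorem bumpMartingale_terminal (T : ℕ) (l S : ℝ) :
    bumpMartingale T l T S = Real.exp (l * (S / √(T : ℝ)) - l ^ 2 / 2)
      * (2 - Real.cosh (S / √(T : ℝ) - l)) := by
  have e (μ : ℝ) : expMartingale T μ T S = Real.exp (μ * (S / √(T : ℝ))) := by
    rw [expMartingale, Nat.sub_self, pow_zero, mul_one]; congr 1; ring
  simp only [bumpMartingale, e]
  generalize S / √(T : ℝ) = x
  have h1 : Real.exp (-l ^ 2 / 2) * Real.exp (l * x) = Real.exp (l * x - l ^ 2 / 2) := by
    rw [← Real.exp_add]; congr 1; ring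
  have h2 : Real.exp (-l ^ 2 / 2 - l) * Real.exp ((l + 1) * x)
      = Real.exp (l * x - l ^ 2 / 2) * Real.exp (x - l) := by
    rw [← Real.exp_add, ← Real.exp_add]; congr 1; ring
  have h3 : Real.exp (-l ^ 2 / 2 + l) * Real.exp ((l - 1) * x)
      = Real.exp (l * x - l ^ 2 / 2) * Real.exp (-(x - l)) := by
    rw [← Real.exp_add, ← Real.exp_add]; congr 1; ring
  rw [Real.cosh_eq]
  linear_combination 2 * h1 - h2 / 2 - h3 / 2

/-- The limit is 2 - √e for every l, and √e < 7/4. -/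
theorem eventually_lt_bumpMartingale (l : ℝ) :
    ∀ᶠ T : ℕ in Filter.atTop, 1 / 4 < bumpMartingale T l 0 0 := by
  have ht : Filter.Tendsto (fun T : ℕ => bumpMartingale T l 0 0) Filter.atTop
      (nhds (2 * Real.exp (-l ^ 2 / 2) * Real.exp (l ^ 2 / 2)
        - Real.exp (-l ^ 2 / 2 - l) / 2 * Real.exp ((l + 1) ^ 2 / 2)
        - Real.exp (-l ^ 2 / 2 + l) / 2 * Real.exp ((l - 1) ^ 2 / 2))) :=
    (((tendsto_expMartingale l).const_mul _).sub
      ((tendsto_expMartingale (l + 1)).const_mul _)).sub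
      ((tendsto_expMartingale (l - 1)).const_mul _)
  refine ht.eventually_const_lt ?_
  have h1 : Real.exp (-l ^ 2 / 2) * Real.exp (l ^ 2 / 2) = 1 := by
    rw [← Real.exp_add, neg_div, neg_add_cancel, Real.exp_zero]
  have h2 : Real.exp (-l ^ 2 / 2 - l) * Real.exp ((l + 1) ^ 2 / 2) = Real.exp (1 / 2) := by
    rw [← Real.exp_add]; congr 1; ring
  have h3 : Real.exp (-l ^ 2 / 2 + l) * Real.exp ((l - 1) ^ 2 / 2) = Real.exp (1 / 2) := by
    rw [← Real.exp_add]; congr 1; ring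
  have h4 : Real.exp (1 / 2) < 7 / 4 := by
    have : Real.exp (1 / 2) ^ 2 < (7 / 4) ^ 2 := by
      rw [← Real.exp_nat_mul]
      norm_num
      linarith [Real.exp_one_lt_d9]
    exact lt_of_pow_lt_pow_left₀ 2 (by norm_num) this
  linarith

theorem abs_le_two_of_cosh_lt_two {y : ℝ} (h : Real.cosh y < 2) : |y| ≤ 2 := by
  have h1 := one_add_sq_div_two_le_cosh y
  exact abs_le_of_sq_le_sq (by linarith) (by norm_num)

/-! ### The lower bound -/

/-- The lower bound at a fixed horizon. -/
theorem exists_adversary_le_regret (A : Algorithm d) {e : E d} (he : ‖e‖ = 1) {C : ℝ} (hC : 0 < C)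
    {T : ℕ} (hT : 0 < T)
    (hA : ∀ adv : Adversary d, regret A adv T 0 ≤ C * √(T : ℝ)) {l : ℝ} (hl : 0 ≤ l)
    (hbump : 1 / 4 < bumpMartingale T l 0 0) {U : ℝ} (hU : 0 ≤ U) :
    ∃ adv : Adversary d, √(T : ℝ) * (U * (l - 2) - 4 * C * Real.exp (l ^ 2 / 2 + 2 * l))
      ≤ regret A adv T (U • e) := by
  have hTp : 0 < √(T : ℝ) := Real.sqrt_pos.2 (by positivity)
  -- The factor 4C√T lifts the initial value above C√T. As the loss is at most C√T, the terminal
  -- value is positive, which confines x = -S/√T to [l - 2, l + 2].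
  obtain ⟨g, hg⟩ := exists_gradients_le_loss_add A he
    (fun t S => 4 * C * √(T : ℝ) * bumpMartingale T l t S) T fun t ht S => by
      rw [bumpMartingale_step T l ht]; ring
  refine ⟨obliviousAdversary g, ?_⟩
  have hA := hA (obliviousAdversary g)
  rw [regret_zero] at hA
  rw [regret]
  simp only [lossGradient_obliviousAdversary, prediction_obliviousAdversary,
    real_inner_smul_right, ← Finset.mul_sum] at hA ⊢
  rw [bumpMartingale_terminal] at hg
  set L := ∑ t ∈ Finset.range T, inner ℝ (g t : E d) (A t fun i : Fin t => g i)
  set S := ∑ t ∈ Finset.range T, inner ℝ (g t : E d) e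
  set x := -S / √(T : ℝ) with hx
  have hSx : S = -(√(T : ℝ) * x) := by rw [hx]; field_simp
  have hK : 0 < 4 * C * √(T : ℝ) := by positivity
  have hstart := mul_lt_mul_of_pos_left hbump hK
  have hpos : 0 < 4 * C * √(T : ℝ) *
      (Real.exp (l * x - l ^ 2 / 2) * (2 - Real.cosh (x - l))) := by linarith
  have hc : Real.cosh (x - l) < 2 := by
    have := pos_of_mul_pos_right (pos_of_mul_pos_right hpos hK.le) (Real.exp_pos _).le
    linarith
  obtain ⟨hx1, hx2⟩ := abs_le.1 (abs_le_two_of_cosh_lt_two hc)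
  have hexp : Real.exp (l * x - l ^ 2 / 2) * (2 - Real.cosh (x - l))
      ≤ Real.exp (l ^ 2 / 2 + 2 * l) * 1 := by
    refine mul_le_mul (Real.exp_le_exp.2 ?_) (by linarith [Real.one_le_cosh (x - l)])
      (by linarith) (Real.exp_pos _).le
    nlinarith
  have h1 := mul_le_mul_of_nonneg_left hexp hK.le
  have h2 := mul_le_mul_of_nonneg_left (by linarith : l - 2 ≤ x) (mul_nonneg hTp.le hU)
  rw [hSx]
  linarith [mul_pos hC hTp]

/-- With l = √(2 log U) - 2, the exponent l²/2 + 2l equals log U - 2, so the penalty is at most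
4CU√T, of lower order than U√(T log U). The bound U ≥ e² ensures l ≥ 0. -/
theorem le_worstRatio (hd : 0 < d) (A : Algorithm d) {C : ℝ} (hC : 0 < C) {T : ℕ} (hT : 0 < T)
    (hA : ∀ adv : Adversary d, regret A adv T 0 ≤ C * √(T : ℝ)) {U : ℝ} (hU : Real.exp 2 ≤ U)
    (hbump : 1 / 4 < bumpMartingale T (√2 * √(Real.log U) - 2) 0 0) :
    ((√2 - (4 + 4 * C) / √(Real.log U) : ℝ) : EReal) ≤ worstRatio A U T := by
  have hU0 : 0 < U := (Real.exp_pos 2).trans_le hU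
  have hlog : 2 ≤ Real.log U := (Real.le_log_iff_exp_le hU0).2 hU
  have hL : 0 < √(Real.log U) := Real.sqrt_pos.2 (by linarith)
  have hTp : 0 < √(T : ℝ) := Real.sqrt_pos.2 (by positivity)
  set m := √2 * √(Real.log U) with hm
  have hm2 : m ^ 2 = 2 * Real.log U := by
    rw [hm, mul_pow, Real.sq_sqrt (by norm_num), Real.sq_sqrt (by linarith)]
  have hm' : 2 ≤ m := by
    refine le_of_sq_le_sq ?_ (by positivity)
    linarith
  have he : ‖(EuclideanSpace.single ⟨0, hd⟩ 1 : E d)‖ = 1 := by simp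
  obtain ⟨adv, hadv⟩ := exists_adversary_le_regret A he hC hT hA (by linarith : 0 ≤ m - 2) hbump
    hU0.le
  refine le_trans ?_ (le_iSup_of_le (U • (EuclideanSpace.single ⟨0, hd⟩ 1 : E d))
    (le_iSup_of_le (by rw [norm_smul, he, mul_one, Real.norm_of_nonneg hU0.le])
      (le_iSup_of_le adv le_rfl)))
  rw [EReal.coe_le_coe_iff, norm_smul, he, mul_one, Real.norm_of_nonneg hU0.le,
    Real.sqrt_mul (by positivity), le_div_iff₀ (by positivity)]
  refine le_trans ?_ hadv
  have hexp : Real.exp ((m - 2) ^ 2 / 2 + 2 * (m - 2)) ≤ U := by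
    rw [← Real.le_log_iff_exp_le hU0]
    nlinarith
  have e1 : (√2 - (4 + 4 * C) / √(Real.log U)) * (U * (√(T : ℝ) * √(Real.log U)))
      = √(T : ℝ) * (U * (m - 2 - 2) - 4 * C * U) := by
    rw [hm]; field_simp; ring
  rw [e1]
  refine mul_le_mul_of_nonneg_left ?_ hTp.le
  have := mul_le_mul_of_nonneg_left hexp (by positivity : 0 ≤ 4 * C)
  linarith

theorem le_liminf_worstRatio (hd : 0 < d) (C : ℝ) (A : Algorithm d)
    (hA : ∀ (adv : Adversary d) (T : ℕ), 0 < T → regret A adv T 0 ≤ C * √(T : ℝ)) :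
    ((√2 : ℝ) : EReal) ≤
      Filter.liminf (fun U : ℝ => Filter.liminf (fun T : ℕ => worstRatio A U T) Filter.atTop)
        Filter.atTop := by
  -- C may be zero or negative, while the scaling of the martingale must be positive.
  set K := max C 1 with hK
  have hK0 : 0 < K := lt_max_of_lt_right one_pos
  have ht : Filter.Tendsto
      (fun U : ℝ => ((√2 - (4 + 4 * K) / √(Real.log U) : ℝ) : EReal))
      Filter.atTop (nhds ((√2 : ℝ) : EReal)) := by
    refine (continuous_coe_real_ereal.tendsto _).comp ?_
    simpa using (tendsto_const_div_sqrt_log (4 + 4 * K)).const_sub √2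
  rw [← ht.liminf_eq]
  refine Filter.liminf_le_liminf ?_
  filter_upwards [Filter.eventually_ge_atTop (Real.exp 2)] with U hU
  refine Filter.le_liminf_of_le (h := ?_)
  filter_upwards [Filter.eventually_gt_atTop 0,
    eventually_lt_bumpMartingale (√2 * √(Real.log U) - 2)] with T hT hbump
  exact le_worstRatio hd A hK0 hT (fun adv => (hA adv T hT).trans
    (mul_le_mul_of_nonneg_right (le_max_left _ _) (Real.sqrt_nonneg _))) hU hbump

end

end OLO

theorem mainTheorem2 (d : ℕ) (hd : 0 < d) :
    -- upper bound for the algorithm `A_{1/2}`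
    (∀ C : ℝ, 0 < C →
      Filter.limsup (fun U : ℝ =>
        Filter.limsup (fun T : ℕ => OLO.worstRatio (OLO.algorithmHalf d C) U T) Filter.atTop)
        Filter.atTop ≤ ((√2 : ℝ) : EReal)) ∧
    -- lower bound for every algorithm whose cumulative loss is at most `C √T`
    (∀ (C : ℝ) (A : OLO.Algorithm d),
      (∀ (adv : OLO.Adversary d) (T : ℕ), 0 < T → OLO.regret A adv T 0 ≤ C * √(T : ℝ)) →
      ((√2 : ℝ) : EReal) ≤
        Filter.liminf (fun U : ℝ =>
          Filter.liminf (fun T : ℕ => OLO.worstRatio A U T) Filter.atTop)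
          Filter.atTop) ∧
    -- `A_{1/2}` is such an algorithm
    (∀ C : ℝ, 0 < C → ∀ (adv : OLO.Adversary d) (T : ℕ), 0 < T →
      OLO.regret (OLO.algorithmHalf d C) adv T 0 ≤ C * √(T : ℝ)) :=
  ⟨fun _ hC => OLO.limsup_worstRatio_algorithmHalf_le hC,
    fun C A hA => OLO.le_liminf_worstRatio hd C A hA,
    fun _ hC adv _ hT => OLO.algorithmHalf_regret_zero_le hC adv hT⟩
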